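/- Let $\mathbf k$ be a field with $\mathrm{char}(\mathbf k)\neq 2$ and let $n\ge 1$. Let $E(n)$ be the Hopf algebra over $\mathbf k$ generated by $c,x_1,\dots,x_n$ with relations $c^2=1$, $cx_i+x_ic=0$, $x_ix_j+x_jx_i=0$, $x_i^2=0$, coproduct $\Delta(c)=c\otimes c$, $\Delta(x_i)=1\otimes x_i+x_i\otimes c$, counit $\varepsilon(c)=1$, $\varepsilon(x_i)=0$ and antipode $S(c)=c$, $S(x_i)=cx_i$. For $P\subseteq\{1,\dots,n\}$ let $x_P$ be the product of the $x_i$, $i\in P$, in increasing order; the elements $x_P,\,cx_P$ form a basis of $E(n)$. Let $1^*,c^*\in E(n)^*$ be the elements of the dual basis corresponding to $1=x_\emptyset$ and $c=cx_\emptyset$, and let $r_0$ be the universal $r$-form $$r_0=1^*\otimes 1^*+c^*\otimes 1^*+1^*\otimes c^*-c^*\otimes c^*$$ on $E(n)$. Let $\Lambda=(\lambda_{ij})$ be a lower triangular $n\times n$ matrix over $\mathbf k$, and let $Cl(1,0,\Lambda)$ be the algebra generated by $u,v_1,\dots,v_n$ with relations $u^2=1$, $uv_i+v_iu=0$, $v_i^2=\lambda_{ii}$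 and $v_iv_j+v_jv_i=\lambda_{ij}$ for $i>j$. It is a right $E(n)^{op}$-comodule algebra through the algebra map $\rho\colon Cl(1,0,\Lambda)\to Cl(1,0,\Lambda)\otimes E(n)^{op}$ with $\rho(u)=u\otimes c$, $\rho(v_i)=1\otimes x_i+v_i\otimes c$. For a Hopf algebra $H$ with universal $r$-form $r$, a finite-dimensional right $H^{op}$-comodule algebra $A$, with coaction $a\mapsto\sum a_{(0)}\otimes a_{(1)}$, is called $(H,r)$-Azumaya if both canonical maps $$F\colon A\#\overline A\to \mathrm{End}(A),\qquad F(a\#\bar b)(d)=\sum a\,d_{(0)}b_{(0)}\,r(d_{(1)}\otimes b_{(1)}),$$ $$G\colon \overline A\# A\to \mathrm{End}(A)^{op},\qquad G(\bar a\# b)(d)=\sum r(a_{(1)}\otimes d_{(1)})\,a_{(0)}d_{(0)}\,b$$ are isomorphisms. Here $\overline A$ is the opposite algebra of $A$ and $\#$ is the tensor product of algebras in the braided monoidal category of right $H$-comodules; as vector spaces $A\#\overline A=\overline A\#A=A\otimes A$. Then $Cl(1,0,\Lambda)$ is $(E(n),r_0)$-Azumaya if and only if $\det(\Lambda+\Lambda^t)\neq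 0$. -/

import Mathlib

noncomputable section

namespace CleftAzumaya

open scoped TensorProduct
open MulOpposite

universe u

/-! ### Algebras in the category of right comodules and the Azumaya property -/

section Azumaya

variable {k H A : Type u} [Field k] [Ring H] [Bialgebra k H] [Ring A] [Algebra k A]

variable (k H A) in
/-- A right `Hᵒᵖ`-comodule algebra structure on `A`, i.e. the structure of an algebra in the
monoidal category of right `H`-comodules in which `M ⊗ N` carries the coaction
`m ⊗ n ↦ ∑ m₀ ⊗ n₀ ⊗ n₁ m₁`. The coaction is an algebra map `A → A ⊗ Hᵒᵖ`; here `Hᵐᵒᵖ` has the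
opposite product and the same coproduct and counit as `H`. -/
structure OpComoduleAlgebra where
  /-- The coaction `a ↦ ∑ a₀ ⊗ a₁`. -/
  coact : A →ₐ[k] A ⊗[k] Hᵐᵒᵖ
  coassoc : (TensorProduct.assoc k A Hᵐᵒᵖ Hᵐᵒᵖ).toLinearMap ∘ₗ
      (coact.toLinearMap.rTensor Hᵐᵒᵖ) ∘ₗ coact.toLinearMap =
    ((Coalgebra.comul (R := k) (A := Hᵐᵒᵖ)).lTensor A) ∘ₗ coact.toLinearMap
  counit_coact : (TensorProduct.rid k A).toLinearMap ∘ₗ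
      ((Coalgebra.counit (R := k) (A := Hᵐᵒᵖ)).lTensor A) ∘ₗ coact.toLinearMap =
    LinearMap.id

namespace OpComoduleAlgebra

/-- The coaction `a ↦ ∑ a₀ ⊗ a₁` as a linear map `A → A ⊗ H`. -/
def coactL (ρ : OpComoduleAlgebra k H A) : A →ₗ[k] A ⊗[k] H :=
  ((opLinearEquiv k (M := H)).symm.toLinearMap.lTensor A) ∘ₗ ρ.coact.toLinearMap

/-- For a bilinear form `r` on `H`, the linear map `a ⊗ b ↦ ∑ r(a₁ ⊗ b₁) a₀ b₀`. -/
def twistedMul (ρ : OpComoduleAlgebra k H A) (r : H ⊗[k] H →ₗ[k] k) : A ⊗[k] A →ₗ[k] A :=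
  (TensorProduct.rid k A).toLinearMap ∘ₗ
    TensorProduct.map (LinearMap.mul' k A) r ∘ₗ
    (TensorProduct.tensorTensorTensorComm k A H A H).toLinearMap ∘ₗ
    TensorProduct.map ρ.coactL ρ.coactL

/-- `F : A # Ā → End(A)`, `F(a # b̄)(c) = ∑ a c₀ b₀ r(c₁ ⊗ b₁)`. -/
def mapF (ρ : OpComoduleAlgebra k H A) (r : H ⊗[k] H →ₗ[k] k) :
    A ⊗[k] A →ₗ[k] Module.End k A :=
  TensorProduct.lift (LinearMap.mk₂ k
    (fun a b => LinearMap.mulLeft k a ∘ₗ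
      (TensorProduct.curry (ρ.twistedMul r)).flip b)
    (fun a a' b => by ext; simp [add_mul])
    (fun t a b => by ext; simp)
    (fun a b b' => by ext; simp [mul_add])
    (fun t a b => by ext; simp))

/-- `G : Ā # A → End(A)ᵒᵖ`, `G(ā # b)(c) = ∑ r(a₁ ⊗ c₁) a₀ c₀ b`. -/
def mapG (ρ : OpComoduleAlgebra k H A) (r : H ⊗[k] H →ₗ[k] k) :
    A ⊗[k] A →ₗ[k] Module.End k A :=
  TensorProduct.lift (LinearMap.mk₂ k
    (fun a b => LinearMap.mulRight k b ∘ₗ TensorProduct.curry (ρ.twistedMul r) a)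
    (fun a a' b => by ext; simp [add_mul])
    (fun t a b => by ext; simp)
    (fun a b b' => by ext; simp [mul_add])
    (fun t a b => by ext; simp))

theorem mapF_apply (ρ : OpComoduleAlgebra k H A) (r : H ⊗[k] H →ₗ[k] k) (a b c : A) :
    ρ.mapF r (a ⊗ₜ b) c = a * ρ.twistedMul r (c ⊗ₜ b) := rfl

theorem mapG_apply (ρ : OpComoduleAlgebra k H A) (r : H ⊗[k] H →ₗ[k] k) (a b c : A) :
    ρ.mapG r (a ⊗ₜ b) c = ρ.twistedMul r (a ⊗ₜ c) * b := rfl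

/-- For a universal `r`-form `r` on `H`, the algebra `A` is `(H, r)`-Azumaya if it is
finite-dimensional (an object of the category of finite-dimensional comodules) and the canonical
comodule algebra maps `F : A # Ā → End(A)` and `G : Ā # A → End(A)ᵒᵖ` are isomorphisms. The
underlying spaces of `A # Ā` and `Ā # A` are `A ⊗ A`. -/
structure IsAzumaya (ρ : OpComoduleAlgebra k H A) (r : H ⊗[k] H →ₗ[k] k) : Prop where
  finite : Module.Finite k A
  bijective_F : Function.Bijective (ρ.mapF r)
  bijective_G : Function.Bijective (ρ.mapG r)

end OpComoduleAlgebra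

end Azumaya

/-! ### The Hopf algebra `E(n)` -/

section E

variable (k : Type u) [Field k] (n : ℕ)

/-- The generators of the free algebra: `none` stands for `c`, `some i` for `x i`. -/
abbrev EFree : Type u := FreeAlgebra k (Option (Fin n))

/-- The defining relations of `E(n)`. -/
inductive ERel : EFree k n → EFree k n → Prop
  | c_sq : ERel (FreeAlgebra.ι k none * FreeAlgebra.ι k none) 1
  | c_x (i : Fin n) : ERel (FreeAlgebra.ι k none * FreeAlgebra.ι k (some i) +
      FreeAlgebra.ι k (some i) * FreeAlgebra.ι k none) 0
  | x_x (i j : Fin n) : ERel (FreeAlgebra.ι k (some i) * FreeAlgebra.ι k (some j) +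
      FreeAlgebra.ι k (some j) * FreeAlgebra.ι k (some i)) 0
  | x_sq (i : Fin n) : ERel (FreeAlgebra.ι k (some i) * FreeAlgebra.ι k (some i)) 0

/-- The algebra `E(n)` generated by `c` and `x i`, `i : Fin n`, with relations
`c² = 1`, `c xᵢ + xᵢ c = 0`, `xᵢ xⱼ + xⱼ xᵢ = 0`, `xᵢ² = 0`. -/
def E : Type u := RingQuot (ERel k n)

instance : Ring (E k n) := inferInstanceAs (Ring (RingQuot (ERel k n)))

instance : Algebra k (E k n) := inferInstanceAs (Algebra k (RingQuot (ERel k n)))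

namespace E

variable {n}

/-- The generator `c`. -/
def c : E k n := RingQuot.mkAlgHom k (ERel k n) (FreeAlgebra.ι k none)

/-- The generators `x i`. -/
def x (i : Fin n) : E k n := RingQuot.mkAlgHom k (ERel k n) (FreeAlgebra.ι k (some i))

theorem c_mul_c : c k * c k = (1 : E k n) := by
  have h := RingQuot.mkAlgHom_rel k (ERel.c_sq (k := k) (n := n))
  rw [map_mul, map_one] at h
  exact h

theorem c_mul_x (i : Fin n) : c k * x k i = -(x k i * c k) := by
  have h := RingQuot.mkAlgHom_rel k (ERel.c_x (k := k) i)
  rw [map_add, map_mul, map_mul, map_zero] at h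
  exact eq_neg_of_add_eq_zero_left h

theorem x_mul_x (i j : Fin n) : x k i * x k j = -(x k j * x k i) := by
  have h := RingQuot.mkAlgHom_rel k (ERel.x_x (k := k) i j)
  rw [map_add, map_mul, map_mul, map_zero] at h
  exact eq_neg_of_add_eq_zero_left h

theorem x_mul_self (i : Fin n) : x k i * x k i = 0 := by
  have h := RingQuot.mkAlgHom_rel k (ERel.x_sq (k := k) i)
  rw [map_mul, map_zero] at h
  exact h

variable {k}

/-- The universal property of the presentation of `E(n)`. -/
def lift {B : Type*} [Ring B] [Algebra k B] (c' : B) (x' : Fin n → B)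
    (h1 : c' * c' = 1) (h2 : ∀ i, c' * x' i + x' i * c' = 0)
    (h3 : ∀ i j, x' i * x' j + x' j * x' i = 0) (h4 : ∀ i, x' i * x' i = 0) : E k n →ₐ[k] B :=
  RingQuot.liftAlgHom k ⟨FreeAlgebra.lift k (fun o => o.elim c' x'), by
    rintro _ _ (_ | i | ⟨i, j⟩ | i) <;> simp [h1, h2, h3, h4]⟩

section lift

variable {B : Type*} [Ring B] [Algebra k B] (c' : B) (x' : Fin n → B)
    (h1 : c' * c' = 1) (h2 : ∀ i, c' * x' i + x' i * c' = 0)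
    (h3 : ∀ i j, x' i * x' j + x' j * x' i = 0) (h4 : ∀ i, x' i * x' i = 0)

@[simp]
theorem lift_c : lift c' x' h1 h2 h3 h4 (c k) = c' := by
  unfold lift c
  erw [RingQuot.liftAlgHom_mkAlgHom_apply]
  simp

@[simp]
theorem lift_x (i : Fin n) : lift c' x' h1 h2 h3 h4 (x k i) = x' i := by
  unfold lift x
  erw [RingQuot.liftAlgHom_mkAlgHom_apply]
  simp

end lift

theorem hom_ext {B : Type*} [Semiring B] [Algebra k B] {f g : E k n →ₐ[k] B}
    (hc : f (c k) = g (c k)) (hx : ∀ i, f (x k i) = g (x k i)) : f = g := by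
  apply RingQuot.ringQuot_ext' k
  apply FreeAlgebra.hom_ext
  funext o
  cases o with
  | none => exact hc
  | some i => exact hx i

variable (k n)

/-- The coproduct: `Δ(c) = c ⊗ c`, `Δ(xᵢ) = 1 ⊗ xᵢ + xᵢ ⊗ c`. -/
def comulHom : E k n →ₐ[k] E k n ⊗[k] E k n :=
  lift (c k ⊗ₜ c k) (fun i => 1 ⊗ₜ x k i + x k i ⊗ₜ c k)
    (by simp [c_mul_c, Algebra.TensorProduct.one_def])
    (fun i => by
      simp only [mul_add, add_mul, Algebra.TensorProduct.tmul_mul_tmul, c_mul_x, c_mul_c,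
        TensorProduct.tmul_neg, TensorProduct.neg_tmul, mul_one, one_mul]
      abel)
    (fun i j => by
      simp only [mul_add, add_mul, Algebra.TensorProduct.tmul_mul_tmul, c_mul_x, c_mul_c,
        TensorProduct.tmul_neg, TensorProduct.neg_tmul, mul_one, one_mul, x_mul_x k i j]
      abel)
    (fun i => by
      simp only [mul_add, add_mul, Algebra.TensorProduct.tmul_mul_tmul, c_mul_x, c_mul_c,
        TensorProduct.tmul_neg, mul_one, one_mul, x_mul_self]
      simp)

/-- The counit: `ε(c) = 1`, `ε(xᵢ) = 0`. -/
def counitHom : E k n →ₐ[k] k :=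
  lift 1 (fun _ => 0) (by simp) (by simp) (by simp) (by simp)

instance : Bialgebra k (E k n) :=
  Bialgebra.ofAlgHom (comulHom k n) (counitHom k n)
    (by
      apply hom_ext
      · simp [comulHom]
      · intro i
        simp [comulHom, TensorProduct.add_tmul, TensorProduct.tmul_add,
          Algebra.TensorProduct.one_def, add_assoc])
    (by apply hom_ext <;> simp [comulHom, counitHom])
    (by apply hom_ext <;> simp [comulHom, counitHom])

variable {n}

@[simp]
theorem comul_c : Coalgebra.comul (R := k) (c k : E k n) = c k ⊗ₜ c k :=
  lift_c ..

@[simp]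
theorem comul_x (i : Fin n) :
    Coalgebra.comul (R := k) (x k i : E k n) = 1 ⊗ₜ x k i + x k i ⊗ₜ c k :=
  lift_x ..

@[simp]
theorem counit_c : Coalgebra.counit (R := k) (c k : E k n) = 1 :=
  lift_c ..

@[simp]
theorem counit_x (i : Fin n) : Coalgebra.counit (R := k) (x k i : E k n) = 0 :=
  lift_x ..

variable (n)

/-- The antipode as an algebra map into the opposite algebra: `S(c) = c`, `S(xᵢ) = c xᵢ`. -/
def antipodeHom : E k n →ₐ[k] (E k n)ᵐᵒᵖ :=
  lift (op (c k)) (fun i => op (c k * x k i))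
    (by rw [← op_mul, c_mul_c, op_one])
    (fun i => by
      rw [← op_mul, ← op_mul, ← op_add, ← mul_assoc, c_mul_c, mul_assoc,
        ← neg_eq_iff_eq_neg.2 (c_mul_x k i), mul_neg, ← mul_assoc, c_mul_c]
      simp)
    (fun i j => by
      have h (i j : Fin n) : c k * x k i * (c k * x k j) = - (x k i * x k j) := by
        rw [c_mul_x, neg_mul, mul_assoc, ← mul_assoc (c k), c_mul_c, one_mul]
      rw [← op_mul, ← op_mul, ← op_add, h, h, x_mul_x k j i]
      simp)
    (fun i => by
      have h (i j : Fin n) : c k * x k i * (c k * x k j) = - (x k i * x k j) := by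
        rw [c_mul_x, neg_mul, mul_assoc, ← mul_assoc (c k), c_mul_c, one_mul]
      rw [← op_mul, h, x_mul_self]
      simp)

/-- The antipode of `E(n)`. -/
def antipodeL : E k n →ₗ[k] E k n :=
  (opLinearEquiv k (M := E k n)).symm.toLinearMap ∘ₗ (antipodeHom k n).toLinearMap

variable {k n}

theorem antipodeL_one : antipodeL k n 1 = 1 := by
  simp [antipodeL]

theorem antipodeL_mul (a b : E k n) :
    antipodeL k n (a * b) = antipodeL k n b * antipodeL k n a := by
  simp [antipodeL]

@[simp]
theorem antipodeL_c : antipodeL k n (c k) = c k := by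
  simp [antipodeL, antipodeHom]

@[simp]
theorem antipodeL_x (i : Fin n) : antipodeL k n (x k i) = c k * x k i := by
  simp [antipodeL, antipodeHom]

theorem induction {p : E k n → Prop} (alg : ∀ t : k, p (algebraMap k _ t)) (hc : p (c k))
    (hx : ∀ i, p (x k i)) (add : ∀ a b, p a → p b → p (a + b))
    (mul : ∀ a b, p a → p b → p (a * b)) (a : E k n) : p a := by
  let S : Subalgebra k (E k n) :=
    { carrier := {a | p a}
      mul_mem' := fun ha hb => mul _ _ ha hb
      add_mem' := fun ha hb => add _ _ ha hb
      algebraMap_mem' := alg }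
  let f : E k n →ₐ[k] S := lift ⟨c k, hc⟩ (fun i => ⟨x k i, hx i⟩)
    (Subtype.ext (c_mul_c k))
    (fun i => Subtype.ext (by simp [c_mul_x]))
    (fun i j => Subtype.ext (by simp [x_mul_x k i j]))
    (fun i => Subtype.ext (by simp [x_mul_self]))
  have h : S.val.comp f = AlgHom.id k _ := by apply hom_ext <;> simp [f]
  have := (f a).2
  rwa [show ((f a : S) : E k n) = a from DFunLike.congr_fun h a] at this

theorem antipode_left_aux (s t : E k n ⊗[k] E k n) (e : k)
    (hs : LinearMap.mul' k (E k n) ((antipodeL k n).rTensor _ s) = algebraMap k _ e) :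
    LinearMap.mul' k (E k n) ((antipodeL k n).rTensor _ (s * t)) =
      e • LinearMap.mul' k (E k n) ((antipodeL k n).rTensor _ t) := by
  induction t with
  | zero => simp
  | add t₁ t₂ h₁ h₂ => simp [mul_add, h₁, h₂]
  | tmul b₁ b₂ =>
    have key : LinearMap.mul' k (E k n) ((antipodeL k n).rTensor _ (s * b₁ ⊗ₜ b₂)) =
        antipodeL k n b₁ *
          LinearMap.mul' k (E k n) ((antipodeL k n).rTensor _ s) * b₂ := by
      clear hs
      induction s with
      | zero => simp
      | add s₁ s₂ h₁ h₂ => simp [add_mul, mul_add, h₁, h₂]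
      | tmul a₁ a₂ => simp [antipodeL_mul, mul_assoc]
    rw [key, hs, ← Algebra.commutes, mul_assoc, Algebra.smul_def]
    simp

theorem antipode_right_aux (s t : E k n ⊗[k] E k n) (e : k)
    (ht : LinearMap.mul' k (E k n) ((antipodeL k n).lTensor _ t) = algebraMap k _ e) :
    LinearMap.mul' k (E k n) ((antipodeL k n).lTensor _ (s * t)) =
      e • LinearMap.mul' k (E k n) ((antipodeL k n).lTensor _ s) := by
  induction s with
  | zero => simp
  | add t₁ t₂ h₁ h₂ => simp [add_mul, h₁, h₂]
  | tmul a₁ a₂ =>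
    have key : LinearMap.mul' k (E k n) ((antipodeL k n).lTensor _ (a₁ ⊗ₜ a₂ * t)) =
        a₁ * LinearMap.mul' k (E k n) ((antipodeL k n).lTensor _ t) * antipodeL k n a₂ := by
      clear ht
      induction t with
      | zero => simp
      | add s₁ s₂ h₁ h₂ => simp [add_mul, mul_add, h₁, h₂]
      | tmul b₁ b₂ => simp [antipodeL_mul, mul_assoc]
    rw [key, ht, ← Algebra.commutes, mul_assoc, Algebra.smul_def]
    simp

theorem antipode_left (a : E k n) :
    LinearMap.mul' k (E k n) ((antipodeL k n).rTensor _ (Coalgebra.comul (R := k) a)) =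
      algebraMap k _ (Coalgebra.counit a) := by
  induction a using induction with
  | alg t => simp [Algebra.algebraMap_eq_smul_one, Algebra.TensorProduct.one_def, antipodeL_one]
  | hc => simp [c_mul_c]
  | hx i => simp [antipodeL_one, mul_assoc, c_mul_x]; simp [← mul_assoc, c_mul_c]
  | add a b ha hb => simp [ha, hb]
  | mul a b ha hb =>
    rw [Bialgebra.comul_mul, antipode_left_aux _ _ _ ha, hb, Bialgebra.counit_mul, map_mul,
      Algebra.smul_def]

theorem antipode_right (a : E k n) :
    LinearMap.mul' k (E k n) ((antipodeL k n).lTensor _ (Coalgebra.comul (R := k) a)) =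
      algebraMap k _ (Coalgebra.counit a) := by
  induction a using induction with
  | alg t => simp [Algebra.algebraMap_eq_smul_one, Algebra.TensorProduct.one_def, antipodeL_one]
  | hc => simp [c_mul_c]
  | hx i => simp [c_mul_x]
  | add a b ha hb => simp [ha, hb]
  | mul a b ha hb =>
    rw [Bialgebra.comul_mul, antipode_right_aux _ _ _ hb, ha, Bialgebra.counit_mul, mul_comm,
      map_mul, Algebra.smul_def]

instance : HopfAlgebra k (E k n) where
  antipode := antipodeL k n
  mul_antipode_rTensor_comul := LinearMap.ext antipode_left
  mul_antipode_lTensor_comul := LinearMap.ext antipode_right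

/-! ### The universal `r`-form `r₀` -/

variable (k n)

/-- The algebra map `E(n) → k` with `c ↦ -1`, `xᵢ ↦ 0`. -/
def signHom : E k n →ₐ[k] k :=
  lift (-1) (fun _ => 0) (by simp) (by simp) (by simp) (by simp)

/-- The functional `1^*` of the dual of the basis `{x_P, c x_P}` of `E(n)`
(see `oneDual_xProd`, `oneDual_c_mul_xProd`). -/
def oneDual : E k n →ₗ[k] k :=
  (2 : k)⁻¹ • ((counitHom k n).toLinearMap + (signHom k n).toLinearMap)

/-- The functional `c^*` of the dual of the basis `{x_P, c x_P}` of `E(n)`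
(see `cDual_xProd`, `cDual_c_mul_xProd`). -/
def cDual : E k n →ₗ[k] k :=
  (2 : k)⁻¹ • ((counitHom k n).toLinearMap - (signHom k n).toLinearMap)

variable {n}

/-- The product `x_P` of the `x i`, `i ∈ P`, in increasing order. -/
def xProd (P : Finset (Fin n)) : E k n := ((P.sort (· ≤ ·)).map (x k)).prod

theorem counitHom_xProd (P : Finset (Fin n)) :
    counitHom k n (xProd k P) = if P = ∅ then 1 else 0 := by
  split_ifs with h
  · simp [h, xProd]
  · obtain ⟨i, hi⟩ := Finset.nonempty_iff_ne_empty.2 h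
    rw [xProd, map_list_prod]
    refine List.prod_eq_zero ?_
    simp only [List.map_map, List.mem_map, Finset.mem_sort]
    exact ⟨i, hi, by simp [counitHom]⟩

theorem signHom_xProd (P : Finset (Fin n)) :
    signHom k n (xProd k P) = if P = ∅ then 1 else 0 := by
  split_ifs with h
  · simp [h, xProd]
  · obtain ⟨i, hi⟩ := Finset.nonempty_iff_ne_empty.2 h
    rw [xProd, map_list_prod]
    refine List.prod_eq_zero ?_
    simp only [List.map_map, List.mem_map, Finset.mem_sort]
    exact ⟨i, hi, by simp [signHom]⟩

theorem oneDual_xProd (hk : (2 : k) ≠ 0) (P : Finset (Fin n)) :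
    oneDual k n (xProd k P) = if P = ∅ then 1 else 0 := by
  by_cases h : P = ∅ <;> simp [oneDual, counitHom_xProd, signHom_xProd, h]
  field_simp
  norm_num

theorem oneDual_c_mul_xProd (P : Finset (Fin n)) : oneDual k n (c k * xProd k P) = 0 := by
  by_cases h : P = ∅ <;>
    simp [oneDual, counitHom_xProd, signHom_xProd, h] <;> simp [counitHom, signHom]

theorem cDual_xProd (P : Finset (Fin n)) : cDual k n (xProd k P) = 0 := by
  by_cases h : P = ∅ <;> simp [cDual, counitHom_xProd, signHom_xProd, h]

theorem cDual_c_mul_xProd (hk : (2 : k) ≠ 0) (P : Finset (Fin n)) :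
    cDual k n (c k * xProd k P) = if P = ∅ then 1 else 0 := by
  by_cases h : P = ∅ <;>
    simp [cDual, counitHom_xProd, signHom_xProd, h]
  simp [counitHom, signHom]
  field_simp
  norm_num

variable (n)

/-- The universal `r`-form `r₀ = 1^* ⊗ 1^* + c^* ⊗ 1^* + 1^* ⊗ c^* - c^* ⊗ c^*`. -/
def r₀ : E k n ⊗[k] E k n →ₗ[k] k :=
  let d (f g : E k n →ₗ[k] k) : E k n ⊗[k] E k n →ₗ[k] k :=
    LinearMap.mul' k k ∘ₗ TensorProduct.map f g
  d (oneDual k n) (oneDual k n) + d (cDual k n) (oneDual k n) +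
    d (oneDual k n) (cDual k n) - d (cDual k n) (cDual k n)

end E

end E

/-! ### The generalized Clifford algebra `Cl(α, γ, Λ)` -/

section Clifford

variable {k : Type u} [Field k] {n : ℕ} (α : k) (γ : Fin n → k) (Λ : Matrix (Fin n) (Fin n) k)

/-- The defining relations of `Cl(α, γ, Λ)`, for a lower triangular matrix `Λ`, in the free
algebra on `u` (`none`) and `v i` (`some i`). -/
inductive ClRel : FreeAlgebra k (Option (Fin n)) → FreeAlgebra k (Option (Fin n)) → Prop
  | u_sq : ClRel (FreeAlgebra.ι k none * FreeAlgebra.ι k none) (algebraMap k _ α)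
  | u_v (i : Fin n) : ClRel (FreeAlgebra.ι k none * FreeAlgebra.ι k (some i) +
      FreeAlgebra.ι k (some i) * FreeAlgebra.ι k none) (algebraMap k _ (γ i))
  | v_sq (i : Fin n) : ClRel (FreeAlgebra.ι k (some i) * FreeAlgebra.ι k (some i))
      (algebraMap k _ (Λ i i))
  | v_v (i j : Fin n) (hij : j < i) : ClRel (FreeAlgebra.ι k (some i) * FreeAlgebra.ι k (some j) +
      FreeAlgebra.ι k (some j) * FreeAlgebra.ι k (some i)) (algebraMap k _ (Λ i j))

/-- The generalized Clifford algebra with generators `u`, `v i` and relations `u² = α`,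
`u vᵢ + vᵢ u = γᵢ`, `vᵢ² = Λᵢᵢ`, `vᵢ vⱼ + vⱼ vᵢ = Λᵢⱼ` for `i > j`. -/
def Cl : Type u := RingQuot (ClRel α γ Λ)

instance : Ring (Cl α γ Λ) := inferInstanceAs (Ring (RingQuot (ClRel α γ Λ)))

instance : Algebra k (Cl α γ Λ) := inferInstanceAs (Algebra k (RingQuot (ClRel α γ Λ)))

namespace Cl

/-- The generator `u`. -/
def u : Cl α γ Λ := RingQuot.mkAlgHom k (ClRel α γ Λ) (FreeAlgebra.ι k none)

/-- The generators `v i`. -/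
def v (i : Fin n) : Cl α γ Λ := RingQuot.mkAlgHom k (ClRel α γ Λ) (FreeAlgebra.ι k (some i))

theorem u_mul_u : u α γ Λ * u α γ Λ = algebraMap k _ α := by
  have h := RingQuot.mkAlgHom_rel k (ClRel.u_sq (α := α) (γ := γ) (Λ := Λ))
  rw [map_mul, AlgHom.commutes] at h
  exact h

theorem u_mul_v (i : Fin n) :
    u α γ Λ * v α γ Λ i + v α γ Λ i * u α γ Λ = algebraMap k _ (γ i) := by
  have h := RingQuot.mkAlgHom_rel k (ClRel.u_v (α := α) (γ := γ) (Λ := Λ) i)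
  rw [map_add, map_mul, map_mul, AlgHom.commutes] at h
  exact h

theorem v_mul_self (i : Fin n) : v α γ Λ i * v α γ Λ i = algebraMap k _ (Λ i i) := by
  have h := RingQuot.mkAlgHom_rel k (ClRel.v_sq (α := α) (γ := γ) (Λ := Λ) i)
  rw [map_mul, AlgHom.commutes] at h
  exact h

theorem v_mul_v (i j : Fin n) (hij : j < i) :
    v α γ Λ i * v α γ Λ j + v α γ Λ j * v α γ Λ i = algebraMap k _ (Λ i j) := by
  have h := RingQuot.mkAlgHom_rel k (ClRel.v_v (α := α) (γ := γ) (Λ := Λ) i j hij)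
  rw [map_add, map_mul, map_mul, AlgHom.commutes] at h
  exact h

/-- The universal property of the presentation of `Cl(α, γ, Λ)`. -/
def lift {B : Type*} [Ring B] [Algebra k B] (u' : B) (v' : Fin n → B)
    (h1 : u' * u' = algebraMap k B α) (h2 : ∀ i, u' * v' i + v' i * u' = algebraMap k B (γ i))
    (h3 : ∀ i, v' i * v' i = algebraMap k B (Λ i i))
    (h4 : ∀ i j, j < i → v' i * v' j + v' j * v' i = algebraMap k B (Λ i j)) :
    Cl α γ Λ →ₐ[k] B :=
  RingQuot.liftAlgHom k ⟨FreeAlgebra.lift k (fun o => o.elim u' v'), by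
    rintro _ _ (_ | i | i | ⟨i, j, hij⟩)
    · simp [h1]
    · simp [h2]
    · simp [h3]
    · simp [h4 i j hij]⟩

section lift

variable {B : Type*} [Ring B] [Algebra k B] (u' : B) (v' : Fin n → B)
    (h1 : u' * u' = algebraMap k B α) (h2 : ∀ i, u' * v' i + v' i * u' = algebraMap k B (γ i))
    (h3 : ∀ i, v' i * v' i = algebraMap k B (Λ i i))
    (h4 : ∀ i j, j < i → v' i * v' j + v' j * v' i = algebraMap k B (Λ i j))

@[simp]
theorem lift_u : lift α γ Λ u' v' h1 h2 h3 h4 (u α γ Λ) = u' := by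
  unfold lift u
  erw [RingQuot.liftAlgHom_mkAlgHom_apply]
  simp

@[simp]
theorem lift_v (i : Fin n) : lift α γ Λ u' v' h1 h2 h3 h4 (v α γ Λ i) = v' i := by
  unfold lift v
  erw [RingQuot.liftAlgHom_mkAlgHom_apply]
  simp

end lift

variable {α γ Λ} in
theorem hom_ext {B : Type*} [Semiring B] [Algebra k B] {f g : Cl α γ Λ →ₐ[k] B}
    (hu : f (u α γ Λ) = g (u α γ Λ)) (hv : ∀ i, f (v α γ Λ i) = g (v α γ Λ i)) : f = g := by
  apply RingQuot.ringQuot_ext' k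
  apply FreeAlgebra.hom_ext
  funext o
  cases o with
  | none => exact hu
  | some i => exact hv i

open Algebra.TensorProduct in
/-- The coaction `ρ(u) = u ⊗ c`, `ρ(vᵢ) = 1 ⊗ xᵢ + vᵢ ⊗ c`, extended to an algebra map
`Cl(α, γ, Λ) → Cl(α, γ, Λ) ⊗ E(n)ᵒᵖ`. -/
def coactHom : Cl α γ Λ →ₐ[k] Cl α γ Λ ⊗[k] (E k n)ᵐᵒᵖ :=
  lift α γ Λ (u α γ Λ ⊗ₜ op (E.c k)) (fun i => 1 ⊗ₜ op (E.x k i) + v α γ Λ i ⊗ₜ op (E.c k))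
    (by
      rw [tmul_mul_tmul, ← op_mul, E.c_mul_c, u_mul_u]
      rfl)
    (fun i => by
      simp only [mul_add, add_mul, tmul_mul_tmul, ← op_mul, E.c_mul_x, E.c_mul_c, op_neg,
        TensorProduct.tmul_neg, mul_one, one_mul]
      have h := congrArg (· ⊗ₜ[k] (op 1 : (E k n)ᵐᵒᵖ)) (u_mul_v α γ Λ i)
      simp only [TensorProduct.add_tmul] at h
      refine Eq.trans ?_ h
      abel)
    (fun i => by
      simp only [mul_add, add_mul, tmul_mul_tmul, ← op_mul, E.c_mul_x, E.c_mul_c, op_neg,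
        TensorProduct.tmul_neg, mul_one, one_mul, E.x_mul_self, v_mul_self, op_zero,
        TensorProduct.tmul_zero]
      refine Eq.trans ?_ (rfl : algebraMap k _ (Λ i i) ⊗ₜ[k] (op 1 : (E k n)ᵐᵒᵖ) = _)
      abel)
    (fun i j hij => by
      simp only [mul_add, add_mul, tmul_mul_tmul, ← op_mul, E.c_mul_x, E.c_mul_c, op_neg,
        TensorProduct.tmul_neg, mul_one, one_mul, E.x_mul_x k i j]
      have h := congrArg (· ⊗ₜ[k] (op 1 : (E k n)ᵐᵒᵖ)) (v_mul_v α γ Λ i j hij)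
      simp only [TensorProduct.add_tmul] at h
      refine Eq.trans ?_ h
      abel)

@[simp]
theorem coactHom_u : coactHom α γ Λ (u α γ Λ) = u α γ Λ ⊗ₜ op (E.c k) := lift_u ..

@[simp]
theorem coactHom_v (i : Fin n) : coactHom α γ Λ (v α γ Λ i) =
    1 ⊗ₜ op (E.x k i) + v α γ Λ i ⊗ₜ op (E.c k) := lift_v ..

/-- `Cl(α, γ, Λ)` as a right `E(n)ᵒᵖ`-comodule algebra. -/
def comoduleAlgebra : OpComoduleAlgebra k (E k n) (Cl α γ Λ) where
  coact := coactHom α γ Λ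
  coassoc := by
    let Δ : (E k n)ᵐᵒᵖ →ₐ[k] (E k n)ᵐᵒᵖ ⊗[k] (E k n)ᵐᵒᵖ :=
      (Algebra.TensorProduct.opAlgEquiv k k (E k n) (E k n)).symm.toAlgHom.comp
        (AlgHom.op (E.comulHom k n))
    have hΔ : Coalgebra.comul (R := k) (A := (E k n)ᵐᵒᵖ) = Δ.toLinearMap := rfl
    have h : (Algebra.TensorProduct.assoc k k k (Cl α γ Λ) (E k n)ᵐᵒᵖ (E k n)ᵐᵒᵖ).toAlgHom.comp
        ((Algebra.TensorProduct.map (coactHom α γ Λ) (.id k _)).comp (coactHom α γ Λ)) =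
        (Algebra.TensorProduct.map (.id k _) Δ).comp (coactHom α γ Λ) := by
      apply hom_ext
      · simp [Δ, E.comulHom]
      · intro i
        simp [Δ, E.comulHom, TensorProduct.add_tmul, TensorProduct.tmul_add, add_assoc,
          Algebra.TensorProduct.one_def]
    rw [hΔ]
    exact congrArg AlgHom.toLinearMap h
  counit_coact := by
    let ε : (E k n)ᵐᵒᵖ →ₐ[k] k := (E.counitHom k n).fromOpposite fun _ _ => Commute.all _ _
    have hε : Coalgebra.counit (R := k) (A := (E k n)ᵐᵒᵖ) = ε.toLinearMap := rfl
    have h : (Algebra.TensorProduct.rid k k (Cl α γ Λ)).toAlgHom.comp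
        ((Algebra.TensorProduct.map (.id k _) ε).comp (coactHom α γ Λ)) = AlgHom.id k _ := by
      apply hom_ext
      · simp [ε, E.counitHom]
      · intro i
        simp [ε, E.counitHom]
    rw [hε]
    exact congrArg AlgHom.toLinearMap h

end Cl

end Clifford

end CleftAzumaya

end

/-! The form `r₀` is a combination of products of the two characters `counitHom` and `signHom` of
`E(n)`. The first acts on `A = Cl(1,0,Λ)` as the identity, the second as the grading automorphism
`σ`, which negates `u` and every `v i`. The twisted product is therefore `(-1)^(|a||b|) a b` on
homogeneous elements (`twistedMul_r₀`), and the Azumaya condition becomes the graded one of Brauer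
and Wall. The algebra is the Clifford algebra of a form whose polar form is `diag(2, Λ + Λᵗ)`, so
the claim is that `F` and `G` are bijective exactly when this polar form is nondegenerate.

If the determinant is nonzero, an orthogonal basis for `Λ + Λᵗ` together with `u` gives
anticommuting odd units `e i` with scalar squares `q i`, and their monomials span `A`. The operators
`d ↦ (q i)⁻¹ e i σ(d) e i` are diagonal on monomials, with signs that tell the monomials apart. The
ranges of `F` and `G` are stable under composition with them, hence under projection to a single
monomial. As monomials are units, one-sided multiplications, which lie in these ranges, send each to
any prescribed element. Hence `F` and `G` are onto, and a dimension count makes them bijective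
(`isAzumaya_of_isOrthogonalFamily`).

If the determinant vanishes, a kernel vector gives a nonzero odd `w` with `w d = σ(d) w` for all
`d`. Then `w ⊗ 1` and `1 ⊗ w` have the same image under `F`, although they are distinct
(`det_ne_zero_of_injective_mapF`). -/

noncomputable section

namespace CleftAzumaya

open scoped TensorProduct
open MulOpposite

universe u

/-! ### Anticommuting odd generators, and a density argument for endomorphisms -/

section Anticommuting

variable {k A ι : Type*} [Field k] [Ring A] [Algebra k A]

/-- The product over a list of indices of those `e i` for which `f i` holds. -/
def monomial (e : ι → A) (l : List ι) (f : ι → Bool) : A :=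
  (l.map fun i => if f i then e i else 1).prod

theorem monomial_cons (e : ι → A) (i : ι) (l : List ι) (f : ι → Bool) :
    monomial e (i :: l) f = (if f i then e i else 1) * monomial e l f := by
  simp [monomial]

theorem monomial_congr (e : ι → A) {l : List ι} {f g : ι → Bool} (h : ∀ i ∈ l, f i = g i) :
    monomial e l f = monomial e l g := by
  unfold monomial
  congr 1
  exact List.map_congr_left fun i hi => by rw [h i hi]

/-- The twisted conjugation `d ↦ q⁻¹ w σ(d) w`. -/
def twistedConj (σ : A →ₐ[k] A) (w : A) (q : k) : Module.End k A :=
  q⁻¹ • (LinearMap.mulLeft k w ∘ₗ LinearMap.mulRight k w ∘ₗ σ.toLinearMap)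

theorem twistedConj_apply (σ : A →ₐ[k] A) (w : A) (q : k) (d : A) :
    twistedConj σ w q d = q⁻¹ • (w * (σ d * w)) := rfl

/-- A family of pairwise anticommuting elements whose squares are nonzero scalars, all of which
are odd for the grading given by `σ`, and which generates `A`. -/
structure IsOrthogonalFamily (σ : A →ₐ[k] A) (e : ι → A) (q : ι → k) : Prop where
  ne_zero (i : ι) : q i ≠ 0
  mul_self (i : ι) : e i * e i = algebraMap k A (q i)
  anticomm (i j : ι) (h : i ≠ j) : e i * e j = -(e j * e i)
  odd (i : ι) : σ (e i) = -e i
  eq_top (p : Submodule k A) (h1 : 1 ∈ p) (h : ∀ i, ∀ a ∈ p, e i * a ∈ p) : p = ⊤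

namespace IsOrthogonalFamily

variable {σ : A →ₐ[k] A} {e : ι → A} {q : ι → k} (h : IsOrthogonalFamily σ e q)

include h

/-- Moving `e j` to its own slot costs only signs. There it either appears or squares to `q j`. -/
theorem mul_monomial [DecidableEq ι] (j : ι) (l : List ι) (hl : l.Nodup) (hj : j ∈ l)
    (f : ι → Bool) : ∃ t : k,
      e j * monomial e l f = t • monomial e l (Function.update f j (!f j)) := by
  induction l with
  | nil => simp at hj
  | cons i l ih =>
    rw [List.nodup_cons] at hl
    simp only [monomial_cons]
    by_cases hij : i = j
    · subst hij
      have hc : monomial e l (Function.update f i (!f i)) = monomial e l f :=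
        monomial_congr e fun a ha => by
          rw [Function.update_of_ne]
          rintro rfl
          exact hl.1 ha
      rw [hc]
      cases hf : f i
      · exact ⟨1, by simp⟩
      · exact ⟨q i, by simp [← mul_assoc, h.mul_self, Algebra.smul_def]⟩
    · obtain ⟨t, ht⟩ := ih hl.2 (by simpa [Ne.symm hij] using hj)
      rw [Function.update_of_ne hij]
      cases hf : f i
      · exact ⟨t, by simpa using ht⟩
      · refine ⟨-t, ?_⟩
        simp only [if_true]
        rw [← mul_assoc, h.anticomm j i (Ne.symm hij), neg_mul, mul_assoc, ht]
        simp

theorem span_monomial [Fintype ι] [DecidableEq ι] :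
    Submodule.span k (Set.range (monomial e Finset.univ.toList)) = ⊤ := by
  apply h.eq_top
  · exact Submodule.subset_span ⟨fun _ => false, by simp [monomial]⟩
  · intro i a ha
    induction ha using Submodule.span_induction with
    | mem x hx =>
      obtain ⟨f, rfl⟩ := hx
      obtain ⟨t, ht⟩ := h.mul_monomial i Finset.univ.toList (Finset.nodup_toList _) (by simp) f
      rw [ht]
      exact Submodule.smul_mem _ _ (Submodule.subset_span ⟨_, rfl⟩)
    | zero => simp
    | add x y _ _ hx hy => rw [mul_add]; exact Submodule.add_mem _ hx hy
    | smul t x _ hx => rw [mul_smul_comm]; exact Submodule.smul_mem _ _ hx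

theorem finite [Fintype ι] [DecidableEq ι] : Module.Finite k A :=
  ⟨⟨(Set.finite_range (monomial e Finset.univ.toList)).toFinset, by
    simpa using h.span_monomial⟩⟩

theorem isUnit (i : ι) : IsUnit (e i) := by
  have h1 : IsUnit (e i * e i) := by
    rw [h.mul_self]
    exact (IsUnit.mk0 _ (h.ne_zero i)).map _
  exact ((Commute.refl (e i)).isUnit_mul_iff.1 h1).1

theorem isUnit_monomial (l : List ι) (f : ι → Bool) : IsUnit (monomial e l f) := by
  induction l with
  | nil => simp [monomial]
  | cons i l ih =>
    rw [monomial_cons]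
    refine IsUnit.mul ?_ ih
    split_ifs
    · exact h.isUnit i
    · exact isUnit_one

/-- For a monomial of degree `m`, `σ` gives `(-1)^m`. Moving `e i` across gives `(-1)^m` again if
`i` does not occur, and one sign fewer if it does. -/
theorem twistedConj_monomial [DecidableEq ι] (i : ι) (l : List ι) (hl : l.Nodup) (f : ι → Bool) :
    twistedConj σ (e i) (q i) (monomial e l f) =
      (if i ∈ l ∧ f i then (-1 : k) else 1) • monomial e l f := by
  induction l with
  | nil =>
    simp [monomial, twistedConj_apply, h.mul_self, Algebra.algebraMap_eq_smul_one, smul_smul,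
      h.ne_zero i]
  | cons j l ih =>
    rw [List.nodup_cons] at hl
    have ih := ih hl.2
    rw [monomial_cons]
    cases hf : f j
    · simp only [Bool.false_eq_true, if_false, one_mul, ih]
      by_cases hij : i = j
      · subst hij; simp [hf]
      · simp [hij]
    · simp only [if_true]
      -- Pulling out `e j` costs one sign from `σ`. For `i ≠ j` anticommutation cancels it; for `i =
      -- j` it survives.
      have key : ∀ d, twistedConj σ (e i) (q i) (e j * d) =
          (if i = j then (-1 : k) else 1) • (e j * twistedConj σ (e i) (q i) d) := by
        intro d
        by_cases hij : i = j
        · subst hij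
          simp [twistedConj_apply, h.odd, mul_assoc]
        · simp only [twistedConj_apply, map_mul, h.odd, hij, if_false, one_smul, mul_smul_comm]
          congr 1
          simp only [← mul_assoc, mul_neg, h.anticomm i j hij, neg_neg]
      rw [key, ih]
      by_cases hij : i = j
      · subst hij; simp [hl.1, hf]
      · simp [hij]

/-- The eigenvalues of the twisted conjugations record which generators occur in a monomial. The
indices in `s` are treated one at a time, each by a spectral projection of an involution on the
monomials. -/
theorem exists_projection [Fintype ι] [DecidableEq ι] (h2 : (2 : k) ≠ 0)
    (R : Submodule k (Module.End k A))
    (hN : ∀ T ∈ R, ∀ i, T ∘ₗ twistedConj σ (e i) (q i) ∈ R) (T : Module.End k A) (hT : T ∈ R)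
    (f : ι → Bool) (s : Finset ι) :
    ∃ T' ∈ R, ∀ g, T' (monomial e Finset.univ.toList g) =
      if ∀ i ∈ s, g i = f i then T (monomial e Finset.univ.toList g) else 0 := by
  induction s using Finset.induction_on with
  | empty => exact ⟨T, hT, by simp⟩
  | insert i s _ ih =>
    obtain ⟨T', hT', hg⟩ := ih
    -- `c` is the eigenvalue on monomials agreeing with `f` at `i`, so `(1 + c N) / 2` fixes these
    -- and kills the others.
    let c : k := if f i then -1 else 1
    refine ⟨(2 : k)⁻¹ • (T' + c • T' ∘ₗ twistedConj σ (e i) (q i)),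
      R.smul_mem _ (R.add_mem hT' (R.smul_mem _ (hN _ hT' i))), fun g => ?_⟩
    have h1 := h.twistedConj_monomial i Finset.univ.toList (Finset.nodup_toList _) g
    simp only [Finset.mem_toList, Finset.mem_univ, true_and] at h1
    simp only [LinearMap.smul_apply, LinearMap.add_apply, LinearMap.comp_apply, h1, map_smul, hg,
      Finset.forall_mem_insert, c]
    by_cases hs : ∀ j ∈ s, g j = f j
    · simp only [eq_true hs, and_true, if_true]
      cases hgi : g i <;> cases hfi : f i <;> simp [← two_smul k, smul_smul, h2]
    · simp [hs]

/-- A space of endomorphisms that is stable under the twisted conjugations and that takes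
every value on every monomial contains all endomorphisms. -/
theorem eq_top_of_comp_mem [Fintype ι] [DecidableEq ι] (h2 : (2 : k) ≠ 0)
    (R : Submodule k (Module.End k A))
    (hN : ∀ T ∈ R, ∀ i, T ∘ₗ twistedConj σ (e i) (q i) ∈ R)
    (hR : ∀ w : A, IsUnit w → ∀ t, ∃ T ∈ R, T w = t) : R = ⊤ := by
  rw [eq_top_iff]
  intro T _
  choose S hS hSt using fun f : ι → Bool =>
    hR _ (h.isUnit_monomial Finset.univ.toList f) (T (monomial e Finset.univ.toList f))
  choose P hP hPg using fun f : ι → Bool => h.exists_projection h2 R hN (S f) (hS f) f Finset.univ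
  -- Each `P f` agrees with `T` on the monomial of `f` and vanishes on the other monomials. Spanning
  -- suffices for the equality; independence of the monomials is not needed.
  have : T = ∑ f, P f := by
    apply LinearMap.ext_on h.span_monomial
    rintro _ ⟨g, rfl⟩
    have hfg : ∀ f : ι → Bool, (∀ i, g i = f i) ↔ g = f := fun f => funext_iff.symm
    simp [LinearMap.sum_apply, hPg, hfg, hSt]
  rw [this]
  exact R.sum_mem fun f _ => hP f

end IsOrthogonalFamily

end Anticommuting

/-! ### Twisted products defined by functionals on the Hopf algebra -/

section TwistedMul

variable {k A H : Type u} [Field k] [Ring H] [Bialgebra k H] [Ring A] [Algebra k A]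

/-- The operator `a ↦ ∑ f(a₁) a₀` of a functional `f` on `H`. -/
def OpComoduleAlgebra.act (ρ : OpComoduleAlgebra k H A) (f : H →ₗ[k] k) : A →ₗ[k] A :=
  (TensorProduct.rid k A).toLinearMap ∘ₗ f.lTensor A ∘ₗ ρ.coactL

theorem OpComoduleAlgebra.twistedMul_map (ρ : OpComoduleAlgebra k H A) (f g : H →ₗ[k] k)
    (a b : A) : ρ.twistedMul (LinearMap.mul' k k ∘ₗ TensorProduct.map f g) (a ⊗ₜ b) =
      ρ.act f a * ρ.act g b := by
  simp only [OpComoduleAlgebra.twistedMul, OpComoduleAlgebra.act, LinearMap.comp_apply,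
    TensorProduct.map_tmul, LinearEquiv.coe_coe]
  generalize ρ.coactL a = x
  generalize ρ.coactL b = y
  induction x with
  | zero => simp
  | add x₁ x₂ h₁ h₂ => simp only [TensorProduct.add_tmul, map_add, h₁, h₂, add_mul]
  | tmul a s =>
    induction y with
    | zero => simp
    | add x₁ x₂ h₁ h₂ => simp only [TensorProduct.tmul_add, map_add, h₁, h₂, mul_add]
    | tmul b t => simp [smul_smul, mul_comm]

theorem OpComoduleAlgebra.twistedMul_add (ρ : OpComoduleAlgebra k H A) (r s : H ⊗[k] H →ₗ[k] k)
    (z : A ⊗[k] A) : ρ.twistedMul (r + s) z = ρ.twistedMul r z + ρ.twistedMul s z := by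
  simp [OpComoduleAlgebra.twistedMul, TensorProduct.map_add_right]

theorem OpComoduleAlgebra.twistedMul_sub (ρ : OpComoduleAlgebra k H A) (r s : H ⊗[k] H →ₗ[k] k)
    (z : A ⊗[k] A) : ρ.twistedMul (r - s) z = ρ.twistedMul r z - ρ.twistedMul s z := by
  rw [eq_sub_iff_add_eq, ← ρ.twistedMul_add, sub_add_cancel]

end TwistedMul

/-! ### The grading automorphism and the twisted product of `r₀` -/

namespace Cl

variable {k : Type u} [Field k] {n : ℕ} (α : k) (γ : Fin n → k) (Λ : Matrix (Fin n) (Fin n) k)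

/-- The grading automorphism, `u ↦ -u`, `v i ↦ -v i`. -/
def grading : Cl α γ Λ →ₐ[k] Cl α γ Λ :=
  lift α γ Λ (-u α γ Λ) (fun i => -v α γ Λ i) (by simp [u_mul_u]) (by simp [u_mul_v])
    (by simp [v_mul_self]) (fun i j hij => by simp [v_mul_v α γ Λ i j hij])

@[simp]
theorem grading_u : grading α γ Λ (u α γ Λ) = -u α γ Λ := lift_u ..

@[simp]
theorem grading_v (i : Fin n) : grading α γ Λ (v α γ Λ i) = -v α γ Λ i := lift_v ..

@[simp]
theorem grading_grading (a : Cl α γ Λ) : grading α γ Λ (grading α γ Λ a) = a := by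
  have : (grading α γ Λ).comp (grading α γ Λ) = AlgHom.id k _ := by
    apply hom_ext <;> simp
  exact DFunLike.congr_fun this a

theorem act_counit (a : Cl α γ Λ) :
    (comoduleAlgebra α γ Λ).act (E.counitHom k n).toLinearMap a = a := by
  have h := LinearMap.congr_fun (comoduleAlgebra α γ Λ).counit_coact a
  refine Eq.trans ?_ h
  simp only [OpComoduleAlgebra.act, OpComoduleAlgebra.coactL, LinearMap.comp_apply]
  rw [← LinearMap.comp_apply (LinearMap.lTensor _ _) (LinearMap.lTensor _ _),
    ← LinearMap.lTensor_comp]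
  rfl

/-- A character of `E(n)` acts by an algebra map, so comparing values on `u` and `v i` is enough. -/
theorem act_sign (a : Cl α γ Λ) :
    (comoduleAlgebra α γ Λ).act (E.signHom k n).toLinearMap a = grading α γ Λ a := by
  let s : (E k n)ᵐᵒᵖ →ₐ[k] k := (E.signHom k n).fromOpposite fun _ _ => Commute.all _ _
  have h : (Algebra.TensorProduct.rid k k (Cl α γ Λ)).toAlgHom.comp
      ((Algebra.TensorProduct.map (.id k _) s).comp (coactHom α γ Λ)) = grading α γ Λ := by
    apply hom_ext
    · simp [s, E.signHom]
    · intro i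
      simp [s, E.signHom]
  rw [← h]
  simp only [OpComoduleAlgebra.act, OpComoduleAlgebra.coactL, LinearMap.comp_apply]
  rw [← LinearMap.comp_apply (LinearMap.lTensor _ _) (LinearMap.lTensor _ _),
    ← LinearMap.lTensor_comp]
  rfl

end Cl

namespace OpComoduleAlgebra

variable {k A : Type u} [Field k] {n : ℕ} [Ring A] [Algebra k A]

theorem act_oneDual (ρ : OpComoduleAlgebra k (E k n) A) (a : A) :
    ρ.act (E.oneDual k n) a = (2 : k)⁻¹ •
      (ρ.act (E.counitHom k n).toLinearMap a + ρ.act (E.signHom k n).toLinearMap a) := by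
  simp [act, E.oneDual, LinearMap.lTensor_smul, LinearMap.lTensor_add]

theorem act_cDual (ρ : OpComoduleAlgebra k (E k n) A) (a : A) :
    ρ.act (E.cDual k n) a = (2 : k)⁻¹ •
      (ρ.act (E.counitHom k n).toLinearMap a - ρ.act (E.signHom k n).toLinearMap a) := by
  simp [act, E.cDual, LinearMap.lTensor_smul, LinearMap.lTensor_sub]

end OpComoduleAlgebra

namespace Cl

variable {k : Type u} [Field k] {n : ℕ} (α : k) (γ : Fin n → k) (Λ : Matrix (Fin n) (Fin n) k)

/-- On homogeneous elements the right side is `(-1)^(|a||b|) a b`. This form avoids splitting into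
even and odd parts. -/
theorem twistedMul_r₀ (h2 : (2 : k) ≠ 0) (a b : Cl α γ Λ) :
    (comoduleAlgebra α γ Λ).twistedMul (E.r₀ k n) (a ⊗ₜ b) =
      (2 : k)⁻¹ • (a * b + a * grading α γ Λ b + grading α γ Λ a * b -
        grading α γ Λ a * grading α γ Λ b) := by
  simp only [E.r₀, OpComoduleAlgebra.twistedMul_add, OpComoduleAlgebra.twistedMul_sub,
    OpComoduleAlgebra.twistedMul_map, OpComoduleAlgebra.act_oneDual, OpComoduleAlgebra.act_cDual,
    act_counit, act_sign]
  generalize grading α γ Λ a = a'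
  generalize grading α γ Λ b = b'
  -- Each product of two dual functionals contributes a factor 1/4; expanding the four terms gives
  -- back a factor 2.
  have h4 : (2 : k)⁻¹ = 2 * ((2 : k)⁻¹ * 2⁻¹) := by field_simp
  conv_rhs => rw [h4]
  simp only [smul_mul_smul_comm, mul_smul, ← smul_add, ← smul_sub]
  rw [smul_comm (2 : k), smul_comm (2 : k)]
  congr 2
  rw [two_smul]
  noncomm_ring

end Cl

/-! ### Surjectivity of `F` and `G` from an orthogonal family -/

namespace Cl

section General

variable {k : Type u} [Field k] {n : ℕ} (α : k) (γ : Fin n → k) (Λ : Matrix (Fin n) (Fin n) k)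

theorem mapF_range_comp (h2 : (2 : k) ≠ 0) (w : Cl α γ Λ) (hw : grading α γ Λ w = -w) (q : k)
    (T : Module.End k (Cl α γ Λ))
    (hT : T ∈ LinearMap.range ((comoduleAlgebra α γ Λ).mapF (E.r₀ k n))) :
    T ∘ₗ twistedConj (grading α γ Λ) w q ∈
      LinearMap.range ((comoduleAlgebra α γ Λ).mapF (E.r₀ k n)) := by
  obtain ⟨z, rfl⟩ := hT
  induction z with
  | zero => simp
  | add x y hx hy => rw [map_add, LinearMap.add_comp]; exact Submodule.add_mem _ hx hy
  | tmul a b =>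
    -- For homogeneous `b` and `d`, replacing `b` by `w b` changes the sign by `(-1)^|d|`, which is
    -- the sign of `σ(d)` in the twisted conjugation.
    refine ⟨q⁻¹ • ((a * w) ⊗ₜ (w * b)), ?_⟩
    ext d
    simp only [map_smul, LinearMap.smul_apply, LinearMap.comp_apply, twistedConj_apply,
      OpComoduleAlgebra.mapF_apply, twistedMul_r₀ α γ Λ h2, map_mul, hw, grading_grading,
      mul_smul_comm]
    congr 2
    noncomm_ring

theorem mapG_range_comp (h2 : (2 : k) ≠ 0) (w : Cl α γ Λ) (hw : grading α γ Λ w = -w) (q : k)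
    (T : Module.End k (Cl α γ Λ))
    (hT : T ∈ LinearMap.range ((comoduleAlgebra α γ Λ).mapG (E.r₀ k n))) :
    T ∘ₗ twistedConj (grading α γ Λ) w q ∈
      LinearMap.range ((comoduleAlgebra α γ Λ).mapG (E.r₀ k n)) := by
  obtain ⟨z, rfl⟩ := hT
  induction z with
  | zero => simp
  | add x y hx hy => rw [map_add, LinearMap.add_comp]; exact Submodule.add_mem _ hx hy
  | tmul a b =>
    -- Here the sign `(-1)^|d|` comes from replacing `a` by `a w`.
    refine ⟨q⁻¹ • ((a * w) ⊗ₜ (w * b)), ?_⟩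
    ext d
    simp only [map_smul, LinearMap.smul_apply, LinearMap.comp_apply, twistedConj_apply,
      OpComoduleAlgebra.mapG_apply, twistedMul_r₀ α γ Λ h2, map_mul, hw, grading_grading,
      smul_mul_assoc]
    congr 2
    noncomm_ring

theorem twistedMul_one_right (h2 : (2 : k) ≠ 0) (a : Cl α γ Λ) :
    (comoduleAlgebra α γ Λ).twistedMul (E.r₀ k n) (a ⊗ₜ 1) = a := by
  rw [twistedMul_r₀ α γ Λ h2]
  simp [← two_smul k, smul_smul, h2]

theorem twistedMul_one_left (h2 : (2 : k) ≠ 0) (a : Cl α γ Λ) :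
    (comoduleAlgebra α γ Λ).twistedMul (E.r₀ k n) (1 ⊗ₜ a) = a := by
  rw [twistedMul_r₀ α γ Λ h2]
  simp only [map_one, one_mul]
  rw [add_right_comm, add_sub_cancel_right, ← two_smul k, smul_smul, inv_mul_cancel₀ h2, one_smul]

theorem isAzumaya_of_isOrthogonalFamily (h2 : (2 : k) ≠ 0) {ι : Type*} [Fintype ι]
    {e : ι → Cl α γ Λ} {q : ι → k} (h : IsOrthogonalFamily (grading α γ Λ) e q) :
    (comoduleAlgebra α γ Λ).IsAzumaya (E.r₀ k n) := by
  classical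
  have hfin := h.finite
  have hdim : Module.finrank k (Cl α γ Λ ⊗[k] Cl α γ Λ) =
      Module.finrank k (Module.End k (Cl α γ Λ)) := by
    rw [Module.finrank_tensorProduct, Module.finrank_linearMap]
  have hbij (f : Cl α γ Λ ⊗[k] Cl α γ Λ →ₗ[k] Module.End k (Cl α γ Λ))
      (hf : LinearMap.range f = ⊤) : Function.Bijective f := by
    have hs := LinearMap.range_eq_top.1 hf
    exact ⟨(LinearMap.injective_iff_surjective_of_finrank_eq_finrank hdim).2 hs, hs⟩
  refine ⟨hfin, hbij _ ?_, hbij _ ?_⟩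
  · refine h.eq_top_of_comp_mem h2 _
      (fun T hT i => mapF_range_comp α γ Λ h2 _ (h.odd i) _ T hT) ?_
    rintro _ ⟨w, rfl⟩ t
    -- On `a ⊗ 1` the twist disappears and `F` is left multiplication by `a`.
    refine ⟨_, ⟨(t * ↑w⁻¹) ⊗ₜ 1, rfl⟩, ?_⟩
    rw [OpComoduleAlgebra.mapF_apply, twistedMul_one_right α γ Λ h2, mul_assoc, Units.inv_mul,
      mul_one]
  · refine h.eq_top_of_comp_mem h2 _
      (fun T hT i => mapG_range_comp α γ Λ h2 _ (h.odd i) _ T hT) ?_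
    rintro _ ⟨w, rfl⟩ t
    refine ⟨_, ⟨1 ⊗ₜ (↑w⁻¹ * t), rfl⟩, ?_⟩
    rw [OpComoduleAlgebra.mapG_apply, twistedMul_one_left α γ Λ h2, ← mul_assoc, Units.mul_inv,
      one_mul]

/-! ### Generators, and the bilinear form on the span of the `v i` -/

theorem induction {p : Cl α γ Λ → Prop} (alg : ∀ t : k, p (algebraMap k _ t)) (hu : p (u α γ Λ))
    (hv : ∀ i, p (v α γ Λ i)) (add : ∀ a b, p a → p b → p (a + b))
    (mul : ∀ a b, p a → p b → p (a * b)) (a : Cl α γ Λ) : p a := by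
  let S : Subalgebra k (Cl α γ Λ) :=
    { carrier := {a | p a}
      mul_mem' := fun ha hb => mul _ _ ha hb
      add_mem' := fun ha hb => add _ _ ha hb
      algebraMap_mem' := alg }
  let f : Cl α γ Λ →ₐ[k] S := lift α γ Λ ⟨u α γ Λ, hu⟩ (fun i => ⟨v α γ Λ i, hv i⟩)
    (Subtype.ext (u_mul_u α γ Λ)) (fun i => Subtype.ext (u_mul_v α γ Λ i))
    (fun i => Subtype.ext (v_mul_self α γ Λ i))
    (fun i j hij => Subtype.ext (v_mul_v α γ Λ i j hij))
  have h : S.val.comp f = AlgHom.id k _ := by apply hom_ext <;> simp [f]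
  have := (f a).2
  rwa [show ((f a : S) : Cl α γ Λ) = a from DFunLike.congr_fun h a] at this

theorem eq_top_of_mul_mem (p : Submodule k (Cl α γ Λ)) (h1 : 1 ∈ p)
    (hu : ∀ a ∈ p, u α γ Λ * a ∈ p) (hv : ∀ i, ∀ a ∈ p, v α γ Λ i * a ∈ p) : p = ⊤ := by
  rw [eq_top_iff]
  intro a ha
  suffices ∀ b ∈ p, a * b ∈ p by simpa using this 1 h1
  clear ha
  induction a using induction with
  | alg t => intro b hb; rw [← Algebra.smul_def]; exact p.smul_mem _ hb
  | hu => exact hu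
  | hv i => exact hv i
  | add a a' h h' => intro b hb; rw [add_mul]; exact p.add_mem (h b hb) (h' b hb)
  | mul a a' h h' => intro b hb; rw [mul_assoc]; exact h _ (h' b hb)

/-- The linear combinations of the `v i`. -/
def vec : (Fin n → k) →ₗ[k] Cl α γ Λ := Fintype.linearCombination k (v α γ Λ)

theorem vec_apply (t : Fin n → k) : vec α γ Λ t = ∑ i, t i • v α γ Λ i := rfl

@[simp]
theorem vec_single (i : Fin n) : vec α γ Λ (Pi.single i 1) = v α γ Λ i := by
  simp [vec]

@[simp]
theorem grading_vec (t : Fin n → k) : grading α γ Λ (vec α γ Λ t) = -vec α γ Λ t := by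
  simp [vec_apply]

theorem v_mul_v_add_swap (hΛ : ∀ i j, i < j → Λ i j = 0) (i j : Fin n) :
    v α γ Λ i * v α γ Λ j + v α γ Λ j * v α γ Λ i =
      algebraMap k _ ((Λ + Λ.transpose) i j) := by
  rw [Matrix.add_apply, Matrix.transpose_apply]
  rcases lt_trichotomy i j with h | rfl | h
  · rw [add_comm, v_mul_v _ _ _ _ _ h, hΛ _ _ h, zero_add]
  · rw [v_mul_self, map_add]
  · rw [v_mul_v _ _ _ _ _ h, hΛ _ _ h, add_zero]

/-- This turns orthogonality for `Λ + Λᵗ` into anticommutation, and vectors in its radical into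
elements anticommuting with every `v i`. -/
theorem vec_mul_vec_add_swap (hΛ : ∀ i j, i < j → Λ i j = 0) (s t : Fin n → k) :
    vec α γ Λ s * vec α γ Λ t + vec α γ Λ t * vec α γ Λ s =
      algebraMap k _ (Matrix.toBilin' (Λ + Λ.transpose) s t) := by
  rw [Matrix.toBilin'_apply, map_sum]
  simp only [vec_apply, Finset.sum_mul_sum]
  rw [Finset.sum_comm (f := fun i j => t i • v α γ Λ i * s j • v α γ Λ j),
    ← Finset.sum_add_distrib]
  refine Finset.sum_congr rfl fun i _ => ?_
  rw [map_sum, ← Finset.sum_add_distrib]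
  refine Finset.sum_congr rfl fun j _ => ?_
  rw [smul_mul_smul_comm, smul_mul_smul_comm, mul_comm (t j), ← smul_add,
    v_mul_v_add_swap _ _ _ hΛ, mul_right_comm, map_mul _ (s i * t j), Algebra.smul_def]

end General

/-! ### Nondegenerate case: diagonalisation -/

variable {k : Type u} [Field k] {n : ℕ} (Λ : Matrix (Fin n) (Fin n) k)

theorem vec_mul_u (t : Fin n → k) :
    vec 1 0 Λ t * u 1 0 Λ = -(u 1 0 Λ * vec 1 0 Λ t) := by
  have h (i : Fin n) : v 1 0 Λ i * u 1 0 Λ = -(u 1 0 Λ * v 1 0 Λ i) := by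
    rw [eq_neg_iff_add_eq_zero, add_comm, u_mul_v]
    simp
  simp [vec_apply, Finset.sum_mul, Finset.mul_sum, h]

/-- Away from characteristic 2 a symmetric form has an orthogonal basis, and nondegeneracy makes its
diagonal values nonzero. Adjoining `u`, which anticommutes with every `vec`, completes the family.
-/
theorem exists_isOrthogonalFamily (h2 : (2 : k) ≠ 0) (hΛ : ∀ i j, i < j → Λ i j = 0)
    (hdet : (Λ + Λ.transpose).det ≠ 0) :
    ∃ (m : ℕ) (e : Option (Fin m) → Cl 1 0 Λ) (q : Option (Fin m) → k),
      IsOrthogonalFamily (grading 1 0 Λ) e q := by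
  let _ : Invertible (2 : k) := invertibleOfNonzero h2
  have hsymm : (Matrix.toBilin' (Λ + Λ.transpose)).IsSymm := by
    rw [LinearMap.BilinForm.isSymm_iff_basis (Pi.basisFun k (Fin n))]
    intro i j
    simp [Matrix.toBilin'_single, add_comm]
  have hnd := LinearMap.BilinForm.nondegenerate_toBilin'_iff_det_ne_zero.2 hdet
  obtain ⟨b, hb⟩ := LinearMap.BilinForm.exists_orthogonal_basis
    (LinearMap.BilinForm.isSymm_iff.1 hsymm)
  have hne := LinearMap.BilinForm.iIsOrtho.not_isOrtho_basis_self_of_nondegenerate hb hnd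
  refine ⟨_, fun o => o.elim (u 1 0 Λ) (fun i => vec 1 0 Λ (b i)),
    -- The anticommutator of a vector with itself is twice its square, hence the factor `2⁻¹`.
    fun o => o.elim 1 (fun i => 2⁻¹ * Matrix.toBilin' (Λ + Λ.transpose) (b i) (b i)), ?_⟩
  constructor
  · rintro (_ | i)
    · exact one_ne_zero
    · exact mul_ne_zero (inv_ne_zero h2) (hne i)
  · rintro (_ | i)
    · exact u_mul_u 1 0 Λ
    · simp only [Option.elim_some]
      rw [map_mul, ← vec_mul_vec_add_swap _ _ _ hΛ, ← two_smul k, ← Algebra.smul_def, smul_smul,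
        inv_mul_cancel₀ h2, one_smul]
  · rintro (_ | i) (_ | j) hij
    · exact absurd rfl hij
    · simp [vec_mul_u]
    · simp [vec_mul_u]
    · have h0 : Matrix.toBilin' (Λ + Λ.transpose) (b i) (b j) = 0 :=
        hb fun h => hij (congrArg some h)
      simp only [Option.elim_some]
      rw [eq_neg_iff_add_eq_zero, vec_mul_vec_add_swap _ _ _ hΛ, h0, map_zero]
  · rintro (_ | i) <;> simp
  · intro p h1 hp
    refine eq_top_of_mul_mem _ _ _ p h1 (hp none) fun i a ha => ?_
    have hvec (t : Fin n → k) : vec 1 0 Λ t * a ∈ p := by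
      rw [← b.sum_repr t, map_sum, Finset.sum_mul]
      refine p.sum_mem fun j _ => ?_
      rw [map_smul, smul_mul_assoc]
      exact p.smul_mem _ (hp (some j) a ha)
    simpa using hvec (Pi.single i 1)

/-! ### Degenerate case: comparison with the Clifford algebra, and failure of injectivity -/

/-- The quadratic form with matrix `diag(1, Λ)`. -/
def quadraticForm : QuadraticForm k (Option (Fin n) → k) :=
  LinearMap.BilinMap.toQuadraticMap (Matrix.toBilin'
    (Matrix.of fun i j => i.elim (j.elim 1 fun _ => 0) fun i => j.elim 0 fun j => Λ i j))

theorem ι_single_mul_self (o : Option (Fin n)) :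
    CliffordAlgebra.ι (quadraticForm Λ) (Pi.single o 1) *
      CliffordAlgebra.ι (quadraticForm Λ) (Pi.single o 1) =
      algebraMap k _ (o.elim 1 fun i => Λ i i) := by
  rw [CliffordAlgebra.ι_sq_scalar]
  cases o <;> simp [quadraticForm, Matrix.toBilin'_single]

theorem ι_single_mul_add_swap (o o' : Option (Fin n)) :
    CliffordAlgebra.ι (quadraticForm Λ) (Pi.single o 1) *
      CliffordAlgebra.ι (quadraticForm Λ) (Pi.single o' 1) +
    CliffordAlgebra.ι (quadraticForm Λ) (Pi.single o' 1) *
      CliffordAlgebra.ι (quadraticForm Λ) (Pi.single o 1) =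
      algebraMap k _ (o.elim (o'.elim 2 fun _ => 0) fun i => o'.elim 0 fun j => Λ i j + Λ j i) := by
  rw [CliffordAlgebra.ι_mul_ι_add_swap]
  cases o <;> cases o' <;>
    simp [quadraticForm, LinearMap.BilinMap.polar_toQuadraticMap, Matrix.toBilin'_single]

/-- The canonical map to the Clifford algebra of `diag(1, Λ)`. -/
def toCliffordAlgebra (hΛ : ∀ i j, i < j → Λ i j = 0) :
    Cl 1 0 Λ →ₐ[k] CliffordAlgebra (quadraticForm Λ) :=
  lift 1 0 Λ (CliffordAlgebra.ι _ (Pi.single none 1))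
    (fun i => CliffordAlgebra.ι _ (Pi.single (some i) 1))
    (ι_single_mul_self Λ none) (fun i => ι_single_mul_add_swap Λ none (some i))
    (fun i => ι_single_mul_self Λ (some i))
    (fun i j hij => by
      simpa [hΛ j i hij] using ι_single_mul_add_swap Λ (some i) (some j))

@[simp]
theorem toCliffordAlgebra_v (hΛ : ∀ i j, i < j → Λ i j = 0) (i : Fin n) :
    toCliffordAlgebra Λ hΛ (v 1 0 Λ i) = CliffordAlgebra.ι _ (Pi.single (some i) 1) := lift_v ..

/-- A relation among the `v i` maps to one among Clifford generators, where contraction with a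
coordinate functional reads off each coefficient. -/
theorem vec_injective (h2 : (2 : k) ≠ 0) (hΛ : ∀ i j, i < j → Λ i j = 0) :
    Function.Injective (vec 1 0 Λ) := by
  let _ : Invertible (2 : k) := invertibleOfNonzero h2
  rw [injective_iff_map_eq_zero]
  intro t ht
  funext i
  have h := congrArg (toCliffordAlgebra Λ hΛ) ht
  simp only [vec_apply, map_sum, map_smul, toCliffordAlgebra_v, map_zero] at h
  have h' := congrArg (CliffordAlgebra.contractLeft (LinearMap.proj (some i))) h
  simp only [map_sum, map_smul, map_zero, CliffordAlgebra.contractLeft_ι] at h'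
  simpa [Algebra.smul_def, ← map_mul, ← map_sum, Pi.single_apply] using h'

/-- A vector in the radical of `Λ + Λᵗ` anticommutes with `u` and every `v i`. The identity is
multiplicative in `d`, so it passes from generators to all of `A`. -/
theorem vec_mul_eq (hΛ : ∀ i j, i < j → Λ i j = 0) (t : Fin n → k)
    (ht : (Λ + Λ.transpose).mulVec t = 0) (d : Cl 1 0 Λ) :
    vec 1 0 Λ t * d = grading 1 0 Λ d * vec 1 0 Λ t := by
  induction d using induction with
  | alg r => rw [AlgHom.commutes, Algebra.commutes]
  | hu => simp [vec_mul_u]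
  | hv i =>
    have h := vec_mul_vec_add_swap 1 0 Λ hΛ (Pi.single i 1) t
    rw [Matrix.toBilin'_apply', ht, dotProduct_zero, map_zero, vec_single] at h
    rw [grading_v, neg_mul]
    exact eq_neg_of_add_eq_zero_right h
  | add a b ha hb => rw [mul_add, ha, hb, map_add, add_mul]
  | mul a b ha hb => rw [← mul_assoc, ha, mul_assoc, hb, map_mul, mul_assoc]

theorem det_ne_zero_of_injective_mapF (h2 : (2 : k) ≠ 0) (hΛ : ∀ i j, i < j → Λ i j = 0)
    (hF : Function.Injective ((comoduleAlgebra 1 0 Λ).mapF (E.r₀ k n))) :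
    (Λ + Λ.transpose).det ≠ 0 := by
  intro hdet
  obtain ⟨t, ht, hΛt⟩ := Matrix.exists_mulVec_eq_zero_iff.2 hdet
  have hw : vec 1 0 Λ t ≠ 0 := fun h => ht (vec_injective Λ h2 hΛ (h.trans (map_zero _).symm))
  -- With `w = vec 1 0 Λ t`, the left side acts as `d ↦ w d`. The right side acts as `d ↦ σ(d) w`,
  -- since `w` is odd.
  have heq : vec 1 0 Λ t ⊗ₜ[k] (1 : Cl 1 0 Λ) = 1 ⊗ₜ vec 1 0 Λ t := by
    apply hF
    ext d
    rw [OpComoduleAlgebra.mapF_apply, OpComoduleAlgebra.mapF_apply,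
      twistedMul_one_right _ _ _ h2, twistedMul_r₀ _ _ _ h2, vec_mul_eq Λ hΛ t hΛt, grading_vec,
      mul_neg, mul_neg, add_neg_cancel, zero_add, sub_neg_eq_add, ← two_smul k, smul_smul,
      inv_mul_cancel₀ h2, one_smul, one_mul]
  -- Applying `σ ⊗ id` negates `w ⊗ 1` and fixes `1 ⊗ w`, so `2 (w ⊗ 1) = 0`. Evaluating `F(w ⊗ 1) =
  -- 0` at `1` then gives `w = 0`.
  have hneg := congrArg (TensorProduct.map (grading 1 0 Λ).toLinearMap LinearMap.id) heq
  simp only [TensorProduct.map_tmul, AlgHom.toLinearMap_apply, grading_vec, map_one,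
    LinearMap.id_apply] at hneg
  rw [← heq, TensorProduct.neg_tmul, neg_eq_iff_add_eq_zero, ← two_smul k] at hneg
  have h0 := LinearMap.congr_fun (congrArg ((comoduleAlgebra 1 0 Λ).mapF (E.r₀ k n))
    ((smul_eq_zero.1 hneg).resolve_left h2)) 1
  rw [OpComoduleAlgebra.mapF_apply, twistedMul_one_right _ _ _ h2, mul_one, map_zero] at h0
  exact hw h0

end Cl

end CleftAzumaya
end

theorem corollary3p3 {k : Type*} [Field k] (hk : ringChar k ≠ 2) (n : ℕ) (hn : 1 ≤ n)
    (Λ : Matrix (Fin n) (Fin n) k) (hΛ : ∀ i j, i < j → Λ i j = 0) :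
    (CleftAzumaya.Cl.comoduleAlgebra 1 0 Λ).IsAzumaya (CleftAzumaya.E.r₀ k n) ↔
      (Λ + Λ.transpose).det ≠ 0 := by
  have h2 : (2 : k) ≠ 0 := Ring.two_ne_zero hk
  constructor
  · intro h
    exact CleftAzumaya.Cl.det_ne_zero_of_injective_mapF Λ h2 hΛ h.bijective_F.1
  · intro hdet
    obtain ⟨m, e, q, h⟩ := CleftAzumaya.Cl.exists_isOrthogonalFamily Λ h2 hΛ hdet
    exact CleftAzumaya.Cl.isAzumaya_of_isOrthogonalFamily 1 0 Λ h2 h
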